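/- Let $n\ge 1$ be an integer. Let $B_n$ be the group of all bijections $\beta$ of $\{-n,\dots,-1,1,\dots,n\}$ onto itself with $\beta(-i)=-\beta(i)$ for all $i$, under composition, and write $\beta=[\beta_1,\dots,\beta_n]$ with $\beta_i=\beta(i)$. Let $\ell_B$ be the length function of $B_n$ with respect to the generators $s_0=[-1,2,\dots,n]$ and $s_i=[1,\dots,i-1,i+1,i,i+2,\dots,n]$ for $1\le i\le n-1$. Let $\operatorname{maj}(\beta)$ be the sum of those $i\in\{1,\dots,n-1\}$ for which $\beta_{i+1}\prec\beta_i$, where $\prec$ is the order $-1\prec-2\prec\cdots\prec-n\prec\cdots\prec0\prec1\prec2\prec\cdots\prec n\prec\cdots$ on $\mathbb Z$, and let $\operatorname{fmaj}(\beta)=2\operatorname{maj}(\beta)+|\{i\in\{1,\dots,n\}:\beta_i<0\}|$. Let $\Delta_n=\{\gamma\in B_n:\gamma(n)>0\}$, and for $\gamma\in\Delta_n$ let $\operatorname{Dmaj}(\gamma)=\operatorname{fmaj}(\gamma)$. For $m\ge1$ let $[m]_q=\frac{1-q^m}{1-q}=1+q+\cdots+q^{m-1}$. If $n$ is even, then $$\sum_{\gamma\in\Delta_n}(-1)^{\ell_B(\gamma)}q^{\operatorname{Dmaj}(\gamma)}=[2]_{-q}[4]_{q}\cdots[2n-2]_{-q}\,[n]_{q},$$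 and if $n$ is odd, then $$\sum_{\gamma\in\Delta_n}(-1)^{\ell_B(\gamma)}q^{\operatorname{Dmaj}(\gamma)}=[2]_{-q}[4]_{q}\cdots[2n-2]_{q}\,[n]_{-q},$$ where in both cases the factors before the last one are $[2i]_{(-1)^iq}$ for $i=1,\dots,n-1$ (none if $n=1$). These are identities of polynomials in $q$ with integer coefficients, and so hold for every element $q$ of every commutative ring. -/

import Mathlib

namespace SignedMahonian

/-- The set `[-n, n] \ {0}` of nonzero integers of absolute value at most `n`. -/
abbrev SignedIdx (n : ℕ) : Type := {z : ℤ // z ∈ (Finset.Icc (-(n : ℤ)) n).erase 0}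

theorem neg_mem_idx {n : ℕ} {z : ℤ} (hz : z ∈ (Finset.Icc (-(n : ℤ)) n).erase 0) :
    -z ∈ (Finset.Icc (-(n : ℤ)) n).erase 0 := by
  simp only [Finset.mem_erase, Finset.mem_Icc] at hz ⊢
  omega

instance instInvolutiveNegSignedIdx (n : ℕ) : InvolutiveNeg (SignedIdx n) where
  neg z := ⟨-z.1, neg_mem_idx z.2⟩
  neg_neg z := Subtype.ext (neg_neg z.1)

theorem coe_neg_idx {n : ℕ} (z : SignedIdx n) : ((-z : SignedIdx n) : ℤ) = -(z : ℤ) := rfl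

/-- The element `i` of `[-n, n] \ {0}`, for `1 ≤ i ≤ n`. -/
def posIdx {n : ℕ} (i : ℕ) (h₁ : 1 ≤ i) (h₂ : i ≤ n) : SignedIdx n :=
  ⟨(i : ℤ), by simp only [Finset.mem_erase, Finset.mem_Icc]; omega⟩

/-- The hyperoctahedral group `B_n`: all bijections `β` of `[-n, n] \ {0}` onto itself with
`β (-i) = -β i`, under composition. -/
def HypGroup (n : ℕ) : Subgroup (Equiv.Perm (SignedIdx n)) where
  carrier := {β | ∀ i, β (-i) = -β i}
  one_mem' _ := rfl
  mul_mem' {a b} ha hb i := by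
    change a (b (-i)) = -a (b i)
    rw [hb i, ha (b i)]
  inv_mem' {a} ha i := by
    change ∀ i, a (-i) = -a i at ha
    apply a.injective
    rw [ha]
    simp

theorem mem_HypGroup {n : ℕ} {β : Equiv.Perm (SignedIdx n)} :
    β ∈ HypGroup n ↔ ∀ i, β (-i) = -β i := Iff.rfl

noncomputable instance instDecidableMemHypGroup (n : ℕ) : DecidablePred (· ∈ HypGroup n) :=
  fun β => inferInstanceAs (Decidable (∀ i, β (-i) = -β i))

noncomputable instance instFintypeHypGroup (n : ℕ) : Fintype (HypGroup n) :=
  inferInstanceAs (Fintype {β : Equiv.Perm (SignedIdx n) // β ∈ HypGroup n})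

theorem neg_idx_ne {n : ℕ} (a : SignedIdx n) : -a ≠ a := by
  intro h
  have h1 := congrArg Subtype.val h
  rw [coe_neg_idx] at h1
  have h2 := (Finset.mem_erase.mp a.2).1
  omega

/-- The generator `s_i = [1, …, i-1, i+1, i, i+2, …, n]`, for `1 ≤ i ≤ n - 1`: it exchanges `i`
with `i + 1`, hence `-i` with `-(i + 1)`. -/
def sGen {n : ℕ} (i : ℕ) (h₁ : 1 ≤ i) (h₂ : i + 1 ≤ n) : HypGroup n :=
  ⟨Equiv.swap (posIdx i h₁ (by omega)) (posIdx (i + 1) (by omega) h₂) *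
      Equiv.swap (-posIdx i h₁ (by omega)) (-posIdx (i + 1) (by omega) h₂), by
    intro j
    apply Subtype.ext
    simp only [Equiv.Perm.mul_apply, Equiv.swap_apply_def, posIdx, Subtype.ext_iff, coe_neg_idx]
    split_ifs <;> simp only [coe_neg_idx] at * <;> omega⟩

/-- The generator `s_0 = [-1, 2, …, n]`, for `n ≥ 1`: it exchanges `1` with `-1`. -/
def sZero {n : ℕ} (h : 1 ≤ n) : HypGroup n :=
  ⟨Equiv.swap (posIdx 1 le_rfl h) (-posIdx 1 le_rfl h), by
    intro j
    apply Subtype.ext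
    simp only [Equiv.swap_apply_def, posIdx, Subtype.ext_iff, coe_neg_idx]
    split_ifs <;> simp only [coe_neg_idx] at * <;> omega⟩

/-- The generating set `S_B = {s_1, …, s_{n-1}, s_0}` of `B_n`. -/
def genB (n : ℕ) : Set (HypGroup n) :=
  {β | (∃ (i : ℕ) (h₁ : 1 ≤ i) (h₂ : i + 1 ≤ n), β = sGen i h₁ h₂) ∨
    ∃ h : 1 ≤ n, β = sZero h}

/-- The length `ℓ_B` of `B_n` with respect to `S_B`: the least length of a word in the
generators that represents `β` (all generators are involutions). -/
noncomputable def lengthB {n : ℕ} (β : HypGroup n) : ℕ :=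
  sInf {k : ℕ | ∃ w : List (HypGroup n), (∀ s ∈ w, s ∈ genB n) ∧ w.prod = β ∧ w.length = k}

/-- The window `[β_1, …, β_n]` of `β`; the entry at `i : Fin n` is `β_{i+1} = β (i + 1)`. -/
def window {n : ℕ} (β : HypGroup n) (i : Fin n) : ℤ :=
  ((β : Equiv.Perm (SignedIdx n)) (posIdx (i.val + 1) (Nat.le_add_left 1 i.val) i.isLt) :
    SignedIdx n)

/-- The strict order `-1 ≺ -2 ≺ ⋯ ≺ -n ≺ ⋯ ≺ 0 ≺ 1 ≺ 2 ≺ ⋯ ≺ n ≺ ⋯` on `ℤ`. -/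
def Prec (a b : ℤ) : Prop :=
  (a < 0 ∧ b < 0 ∧ b < a) ∨ (a < 0 ∧ 0 ≤ b) ∨ (0 ≤ a ∧ 0 ≤ b ∧ a < b)

instance instDecidablePrec (a b : ℤ) : Decidable (Prec a b) := by
  unfold Prec; infer_instance

/-- The descents of a sequence of integers with respect to `≺`; the element `i : Fin n` of this
set stands for the descent at position `i + 1`. -/
def descents {n : ℕ} (v : Fin n → ℤ) : Finset (Fin n) :=
  Finset.univ.filter fun i => ∃ h : i.val + 1 < n, Prec (v ⟨i.val + 1, h⟩) (v i)

/-- The major index (with respect to `≺`): the sum of the positions of the descents. -/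
def maj {n : ℕ} (v : Fin n → ℤ) : ℕ := ∑ i ∈ descents v, (i.val + 1)

/-- `N_1`: the number of negative entries. -/
def negCount {n : ℕ} (v : Fin n → ℤ) : ℕ := (Finset.univ.filter fun i => v i < 0).card

/-- The flag-major index `fmaj β = 2 maj β + N_1 β`. -/
def fmaj {n : ℕ} (β : HypGroup n) : ℕ := 2 * maj (window β) + negCount (window β)

/-- `Δ_n`, for `n ≥ 1`: the signed permutations `γ` with `γ(n) > 0`. -/
abbrev Delta (n : ℕ) : Type :=
  {γ : HypGroup n // ∃ h : 1 ≤ n, 0 < window γ ⟨n - 1, Nat.sub_lt h Nat.one_pos⟩}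

/-- The `D`-major index on `Δ_n`. -/
def Dmaj {n : ℕ} (γ : Delta n) : ℕ := fmaj γ.1

/-- The `q`-integer `[m]_q = (1 - q^m) / (1 - q) = 1 + q + ⋯ + q^{m-1}`. -/
def qInt {R : Type*} [CommRing R] (m : ℕ) (q : R) : R := ∑ i ∈ Finset.range m, q ^ i

theorem qInt_mul {R : Type*} [CommRing R] (m : ℕ) (q : R) :
    qInt m q * (1 - q) = 1 - q ^ m := geom_sum_mul_neg q m

end SignedMahonian

/-!
Let `c = s_n ⋯ s_1 s_0` in `B_{n+1}`. In the order `-1 ≺ ⋯ ≺ -(n+1) ≺ 1 ≺ ⋯ ≺ n+1` it is the cyclic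
predecessor map, so every element of `B_{n+1}` is uniquely `c ^ k * β` with `0 ≤ k < 2n + 2` and `β`
in the stabilizer `B_n` of `n + 1` (`bijective_cyc_pow_mul_incl`).

Multiplying by `c` from the left raises `fmaj` by exactly `1`, as long as the window does not end
in `-1` (`fmaj_cyc_mul`): the relative order of the entries changes only at the entry `-1`, which
becomes the maximum `n + 1`. Then one negative entry is lost, and the descent at the position before
it (none if it is the first entry) is replaced by a descent at its own position. If the entry `1`
occurs instead, only the number of negative entries changes, by one. Hence
`fmaj (c ^ k * β) = fmaj β + k`.

The parity of the length is a linear character: `signB` is a homomorphism with value `-1` at all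
generators, and the same decomposition shows that these generate. As `c` is a product of `n + 1`
generators, the element `c ^ k * β` contributes `((-1) ^ (n + 1) * q) ^ k` times the contribution
of `β`, and the sum over `B_{n+1}` is `[2n + 2]` at `(-1) ^ (n + 1) * q` times the sum over `B_n`
(`sum_weight`). Since `c ^ k` maps `n + 1` to a positive number exactly for `k < n + 1`, the sum
over `Δ_{n+1}` has the factor `[n + 1]` in place of `[2n + 2]` (`sum_delta_weight`).
-/

namespace SignedMahonian

/-! ### Values of the generators -/

theorem mem_idx_iff {n : ℕ} {z : ℤ} :
    z ∈ (Finset.Icc (-(n : ℤ)) n).erase 0 ↔ z ≠ 0 ∧ -(n : ℤ) ≤ z ∧ z ≤ n := by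
  simp only [Finset.mem_erase, Finset.mem_Icc]

theorem idx_bounds {n : ℕ} (x : SignedIdx n) : (x : ℤ) ≠ 0 ∧ -(n : ℤ) ≤ x ∧ (x : ℤ) ≤ n :=
  mem_idx_iff.1 x.2

theorem apply_neg {n : ℕ} (β : HypGroup n) (x : SignedIdx n) : β.1 (-x) = -β.1 x := β.2 x

theorem coe_mul_apply {n : ℕ} (β γ : HypGroup n) (x : SignedIdx n) :
    (β * γ).1 x = β.1 (γ.1 x) := rfl

theorem hypGroup_ext {n : ℕ} {β γ : HypGroup n} (h : ∀ x, (β.1 x : ℤ) = γ.1 x) : β = γ :=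
  Subtype.ext (Equiv.ext fun x => Subtype.ext (h x))

theorem coe_posIdx {n : ℕ} (i : ℕ) (h₁ : 1 ≤ i) (h₂ : i ≤ n) :
    ((posIdx i h₁ h₂ : SignedIdx n) : ℤ) = i := rfl

theorem coe_sGen_apply {n : ℕ} (i : ℕ) (h₁ : 1 ≤ i) (h₂ : i + 1 ≤ n) (x : SignedIdx n) :
    ((sGen i h₁ h₂).1 x : ℤ) =
      if (x : ℤ) = i then (i : ℤ) + 1 else if (x : ℤ) = i + 1 then (i : ℤ)
      else if (x : ℤ) = -i then -((i : ℤ) + 1) else if (x : ℤ) = -(i + 1) then -(i : ℤ)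
      else x := by
  simp only [sGen, Equiv.Perm.mul_apply, Equiv.swap_apply_def, posIdx, Subtype.ext_iff,
    coe_neg_idx]
  split_ifs <;> (try simp only [coe_neg_idx] at *) <;> push_cast at * <;> omega

theorem coe_sZero_apply {n : ℕ} (h : 1 ≤ n) (x : SignedIdx n) :
    ((sZero h).1 x : ℤ) =
      if (x : ℤ) = 1 then (-1 : ℤ) else if (x : ℤ) = -1 then (1 : ℤ) else x := by
  simp only [sZero, Equiv.swap_apply_def, posIdx, Subtype.ext_iff, coe_neg_idx]
  split_ifs <;> (try simp only [coe_neg_idx] at *) <;> push_cast at * <;> omega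

/-! ### The embedding of `B_n` into `B_{n+1}` -/

/-- `[-n, n] \ {0}` as the part of `[-(n+1), n+1] \ {0}` on which `|x| ≤ n`. -/
def idxEquiv (n : ℕ) : SignedIdx n ≃ {x : SignedIdx (n + 1) // |(x : ℤ)| ≤ n} where
  toFun x := ⟨⟨x, mem_idx_iff.2 (by have := idx_bounds x; push_cast; omega)⟩,
    abs_le.2 (idx_bounds x).2⟩
  invFun x := ⟨x.1, mem_idx_iff.2 ⟨(idx_bounds x.1).1, abs_le.1 x.2⟩⟩
  left_inv _ := rfl
  right_inv _ := rfl

theorem coe_idxEquiv {n : ℕ} (x : SignedIdx n) : (((idxEquiv n x).1 : SignedIdx (n + 1)) : ℤ) = x :=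
  rfl

theorem extendDomain_small {n : ℕ} (β : Equiv.Perm (SignedIdx n)) (x : SignedIdx n)
    (y : SignedIdx (n + 1)) (h : (y : ℤ) = x) :
    ((β.extendDomain (idxEquiv n) y : SignedIdx (n + 1)) : ℤ) = β x := by
  have hy : y = (idxEquiv n x).1 := Subtype.ext h
  rw [hy, Equiv.Perm.extendDomain_apply_image, coe_idxEquiv]

theorem extendDomain_large {n : ℕ} (β : Equiv.Perm (SignedIdx n))
    (y : SignedIdx (n + 1)) (h : ¬ |(y : ℤ)| ≤ n) :
    β.extendDomain (idxEquiv n) y = y :=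
  Equiv.Perm.extendDomain_apply_not_subtype _ _ h

/-- The embedding `[β_1, …, β_n] ↦ [β_1, …, β_n, n + 1]` of `B_n` into `B_{n+1}`. -/
def incl (n : ℕ) : HypGroup n →* HypGroup (n + 1) :=
  ((Equiv.Perm.extendDomainHom (idxEquiv n)).comp (HypGroup n).subtype).codRestrict
    (HypGroup (n + 1)) fun β y => by
      change β.1.extendDomain (idxEquiv n) (-y) = -β.1.extendDomain (idxEquiv n) y
      apply Subtype.ext
      by_cases h : |(y : ℤ)| ≤ n
      · obtain ⟨x, hx⟩ := (idxEquiv n).surjective ⟨y, h⟩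
        have hx' : (y : ℤ) = x := by rw [← coe_idxEquiv x, hx]
        rw [coe_neg_idx, extendDomain_small β.1 x y hx',
          extendDomain_small β.1 (-x) (-y) (by rw [coe_neg_idx, coe_neg_idx, hx']), apply_neg,
          coe_neg_idx]
      · rw [extendDomain_large _ _ h, extendDomain_large _ _ (by rwa [coe_neg_idx, abs_neg])]

theorem coe_incl_small {n : ℕ} (β : HypGroup n) (x : SignedIdx n) (y : SignedIdx (n + 1))
    (h : (y : ℤ) = x) : (((incl n β).1 y : SignedIdx (n + 1)) : ℤ) = β.1 x :=
  extendDomain_small β.1 x y h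

theorem incl_large {n : ℕ} (β : HypGroup n) (y : SignedIdx (n + 1)) (h : ¬ |(y : ℤ)| ≤ n) :
    (incl n β).1 y = y :=
  extendDomain_large β.1 y h

theorem exists_idx_of_abs_le {n : ℕ} (y : SignedIdx (n + 1)) (h : |(y : ℤ)| ≤ n) :
    ∃ x : SignedIdx n, (y : ℤ) = x :=
  ⟨(idxEquiv n).symm ⟨y, h⟩, rfl⟩

theorem incl_injective (n : ℕ) : Function.Injective (incl n) := by
  intro β γ h
  refine hypGroup_ext fun x => ?_
  rw [← coe_incl_small β x (idxEquiv n x).1 rfl, h, coe_incl_small γ x (idxEquiv n x).1 rfl]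

/-- The element `n + 1` of `[-(n+1), n+1] \ {0}`. -/
abbrev top (n : ℕ) : SignedIdx (n + 1) := posIdx (n + 1) (Nat.le_add_left 1 n) le_rfl

theorem incl_top {n : ℕ} (β : HypGroup n) : (incl n β).1 (top n) = top n :=
  incl_large _ _ (by rw [coe_posIdx, abs_of_nonneg (by positivity)]; push_cast; omega)

theorem eq_top_or_neg_top {n : ℕ} (y : SignedIdx (n + 1)) (h : ¬ |(y : ℤ)| ≤ n) :
    y = top n ∨ y = -top n := by
  have hy := idx_bounds y
  rw [abs_le] at h
  simp only [Subtype.ext_iff, coe_neg_idx, coe_posIdx]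
  push_cast at *
  omega

/-- The image of `B_n` in `B_{n+1}` is the stabilizer of `n + 1`. -/
theorem exists_incl_eq {n : ℕ} (β : HypGroup (n + 1)) (h : β.1 (top n) = top n) :
    ∃ γ, incl n γ = β := by
  have hneg : β.1 (-top n) = -top n := by rw [apply_neg, h]
  have hiff : ∀ y : SignedIdx (n + 1), |((β.1 y : SignedIdx (n + 1)) : ℤ)| ≤ n ↔ |(y : ℤ)| ≤ n := by
    intro y
    have key : ¬ |((top n : SignedIdx (n + 1)) : ℤ)| ≤ n := by
      rw [coe_posIdx, abs_of_nonneg (by positivity)]; push_cast; omega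
    have key' : ¬ |((-top n : SignedIdx (n + 1)) : ℤ)| ≤ n := by rwa [coe_neg_idx, abs_neg]
    constructor
    · intro hy
      by_contra hc
      rcases eq_top_or_neg_top y hc with rfl | rfl
      · exact key (by rwa [h] at hy)
      · exact key' (by rwa [hneg] at hy)
    · intro hy
      by_contra hc
      rcases eq_top_or_neg_top _ hc with he | he
      · exact key (by rwa [β.1.injective (he.trans h.symm)] at hy)
      · exact key' (by rwa [β.1.injective (he.trans hneg.symm)] at hy)
  set ρ : Equiv.Perm (SignedIdx n) := (idxEquiv n).permCongr.symm (β.1.subtypePerm hiff) with hρ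
  have hval : ∀ x, ((ρ x : SignedIdx n) : ℤ) = β.1 (idxEquiv n x).1 := fun x => rfl
  refine ⟨⟨ρ, fun x => Subtype.ext ?_⟩, hypGroup_ext fun y => ?_⟩
  · rw [coe_neg_idx, hval, hval, ← coe_neg_idx, ← apply_neg]
    rfl
  · by_cases hy : |(y : ℤ)| ≤ n
    · obtain ⟨x, hx⟩ := exists_idx_of_abs_le y hy
      rw [coe_incl_small _ x y hx]
      exact (hval x).trans (by rw [show (idxEquiv n x).1 = y from Subtype.ext hx.symm])
    · rw [incl_large _ _ hy]
      rcases eq_top_or_neg_top y hy with rfl | rfl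
      · rw [h]
      · rw [hneg]

theorem incl_sGen {n : ℕ} (i : ℕ) (h₁ : 1 ≤ i) (h₂ : i + 1 ≤ n) :
    incl n (sGen i h₁ h₂) = sGen i h₁ (by omega) := by
  refine hypGroup_ext fun y => ?_
  rw [coe_sGen_apply]
  by_cases hy : |(y : ℤ)| ≤ n
  · obtain ⟨x, hx⟩ := exists_idx_of_abs_le y hy
    rw [coe_incl_small _ x y hx, coe_sGen_apply, hx]
  · rw [incl_large _ _ hy]
    rw [abs_le] at hy
    split_ifs <;> omega

theorem incl_sZero {n : ℕ} (h : 1 ≤ n) : incl n (sZero h) = sZero (by omega) := by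
  refine hypGroup_ext fun y => ?_
  rw [coe_sZero_apply]
  by_cases hy : |(y : ℤ)| ≤ n
  · obtain ⟨x, hx⟩ := exists_idx_of_abs_le y hy
    rw [coe_incl_small _ x y hx, coe_sZero_apply, hx]
  · rw [incl_large _ _ hy]
    rw [abs_le] at hy
    split_ifs <;> omega

/-! ### The cycle of order `2n + 2` -/

/-- The product `s_n ⋯ s_1 s_0` in `B_{n+1}`, with window `[-(n+1), 1, 2, …, n]`. It moves every
element one step down in `-1 ≺ ⋯ ≺ -(n+1) ≺ 1 ≺ ⋯ ≺ n+1`, cyclically. -/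
def cyc : (n : ℕ) → HypGroup (n + 1)
  | 0 => sZero le_rfl
  | n + 1 => sGen (n + 1) (Nat.le_add_left 1 n) le_rfl * incl (n + 1) (cyc n)

/-- The cyclic predecessor map of `-1 ≺ ⋯ ≺ -N ≺ 1 ≺ ⋯ ≺ N`. -/
def cycPred (N z : ℤ) : ℤ :=
  if z = 1 then -N else if z = -1 then N else if 0 < z then z - 1 else z + 1

theorem cycPred_one (N : ℤ) : cycPred N 1 = -N := rfl

theorem cycPred_neg_one (N : ℤ) : cycPred N (-1) = N := rfl

theorem coe_cyc_apply (n : ℕ) (x : SignedIdx (n + 1)) :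
    ((cyc n).1 x : ℤ) = cycPred (n + 1) x := by
  induction n with
  | zero =>
    have := idx_bounds x
    rw [cyc, coe_sZero_apply, cycPred]
    push_cast at *
    split_ifs <;> omega
  | succ n ih =>
    have := idx_bounds x
    rw [cyc, coe_mul_apply, coe_sGen_apply]
    by_cases hx : |(x : ℤ)| ≤ (n + 1 : ℕ)
    · obtain ⟨y, hy⟩ := exists_idx_of_abs_le x hx
      rw [coe_incl_small _ y x hy, ih, hy, cycPred, cycPred]
      have := idx_bounds y
      push_cast at *
      split_ifs <;> omega
    · rw [incl_large _ _ hx, cycPred]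
      rw [abs_le] at hx
      push_cast at *
      split_ifs <;> omega

theorem coe_cyc_pow_top (n k : ℕ) (hk : k < 2 * n + 2) :
    (((cyc n) ^ k).1 (top n) : ℤ) = if k ≤ n then (n : ℤ) + 1 - k else k - (2 * n + 2) := by
  induction k with
  | zero => simp [coe_posIdx]
  | succ k ih =>
    rw [pow_succ', coe_mul_apply, coe_cyc_apply, ih (by omega), cycPred]
    push_cast
    split_ifs <;> omega

/-- Every element of `B_{n+1}` is uniquely `c ^ k * β` with `c` the cycle, `k < 2n + 2` and
`β ∈ B_n`; here `k` is determined by the image of `n + 1`. -/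
theorem bijective_cyc_pow_mul_incl (n : ℕ) : Function.Bijective
    fun p : Fin (2 * n + 2) × HypGroup n => cyc n ^ (p.1 : ℕ) * incl n p.2 := by
  constructor
  · rintro ⟨k, β⟩ ⟨l, γ⟩ h
    dsimp only at h
    have hv : (((cyc n) ^ (k : ℕ)).1 (top n) : ℤ) = ((cyc n) ^ (l : ℕ)).1 (top n) := by
      have := congrArg (fun δ : HypGroup (n + 1) => (δ.1 (top n) : ℤ)) h
      simpa only [coe_mul_apply, incl_top] using this
    have hkl : k = l := by
      rw [coe_cyc_pow_top n k k.2, coe_cyc_pow_top n l l.2] at hv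
      apply Fin.ext
      have := k.2
      have := l.2
      split_ifs at hv <;> omega
    subst hkl
    rw [incl_injective n (mul_left_cancel h)]
  · intro β
    obtain ⟨k, hk, hv⟩ : ∃ k, k < 2 * n + 2 ∧ ((cyc n) ^ k).1 (top n) = β.1 (top n) := by
      have hb := idx_bounds (β.1 (top n))
      push_cast at hb
      by_cases hpos : 0 < ((β.1 (top n) : SignedIdx (n + 1)) : ℤ)
      · refine ⟨((n : ℤ) + 1 - β.1 (top n)).toNat, by omega, Subtype.ext ?_⟩
        rw [coe_cyc_pow_top _ _ (by omega)]
        split_ifs <;> omega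
      · refine ⟨((2 * n : ℤ) + 2 + β.1 (top n)).toNat, by omega, Subtype.ext ?_⟩
        rw [coe_cyc_pow_top _ _ (by omega)]
        split_ifs <;> omega
    obtain ⟨γ, hγ⟩ := exists_incl_eq ((cyc n ^ k)⁻¹ * β) (by
      rw [coe_mul_apply, ← hv, ← coe_mul_apply, inv_mul_cancel]; rfl)
    exact ⟨(⟨k, hk⟩, γ), by simp only [hγ, mul_inv_cancel_left]⟩

/-! ### The sign character and the parity of the length -/

theorem incl_mem_genB {n : ℕ} {β : HypGroup n} (h : β ∈ genB n) : incl n β ∈ genB (n + 1) := by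
  rcases h with ⟨i, h₁, h₂, rfl⟩ | ⟨h, rfl⟩
  · exact Or.inl ⟨i, h₁, by omega, incl_sGen i h₁ h₂⟩
  · exact Or.inr ⟨by omega, incl_sZero h⟩

theorem incl_mem_closure {n : ℕ} {β : HypGroup n} (h : β ∈ Subgroup.closure (genB n)) :
    incl n β ∈ Subgroup.closure (genB (n + 1)) := by
  have h' := Subgroup.mem_map_of_mem (incl n) h
  rw [MonoidHom.map_closure] at h'
  exact Subgroup.closure_mono (by rintro _ ⟨γ, hγ, rfl⟩; exact incl_mem_genB hγ) h'

theorem cyc_mem_closure (n : ℕ) : cyc n ∈ Subgroup.closure (genB (n + 1)) := by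
  induction n with
  | zero => exact Subgroup.subset_closure (Or.inr ⟨le_rfl, rfl⟩)
  | succ n ih =>
    exact mul_mem (Subgroup.subset_closure (Or.inl ⟨n + 1, by omega, le_rfl, rfl⟩))
      (incl_mem_closure ih)

theorem subsingleton_hypGroup_zero : Subsingleton (HypGroup 0) :=
  ⟨fun β γ => hypGroup_ext fun x => by have := idx_bounds x; push_cast at this; omega⟩

theorem closure_genB (n : ℕ) : Subgroup.closure (genB n) = ⊤ := by
  induction n with
  | zero =>
    have := subsingleton_hypGroup_zero
    exact Subsingleton.elim _ _
  | succ n ih =>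
    refine (Subgroup.eq_top_iff' _).2 fun β => ?_
    obtain ⟨⟨k, γ⟩, rfl⟩ := (bijective_cyc_pow_mul_incl n).2 β
    exact mul_mem (pow_mem (cyc_mem_closure n) _) (incl_mem_closure (by rw [ih]; trivial))

theorem genB_mul_self {n : ℕ} {s : HypGroup n} (h : s ∈ genB n) : s * s = 1 := by
  refine hypGroup_ext fun x => ?_
  change ((s.1 (s.1 x) : SignedIdx n) : ℤ) = x
  rcases h with ⟨i, h₁, h₂, rfl⟩ | ⟨h, rfl⟩
  · rw [coe_sGen_apply, coe_sGen_apply]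
    split_ifs <;> omega
  · rw [coe_sZero_apply, coe_sZero_apply]
    by_cases h₁ : (x : ℤ) = 1
    · simp [h₁]
    · by_cases h₂ : (x : ℤ) = -1
      · simp [h₂]
      · simp [h₁, h₂]

/-- Every signed permutation is a product of generators, so that the set of word lengths whose
infimum is `lengthB β` is nonempty. -/
theorem exists_word {n : ℕ} (β : HypGroup n) :
    ∃ w : List (HypGroup n), (∀ s ∈ w, s ∈ genB n) ∧ w.prod = β := by
  have hinv : (genB n)⁻¹ = genB n := by
    rw [← Set.image_inv_eq_inv]
    exact (Set.image_congr fun s hs => inv_eq_of_mul_eq_one_left (genB_mul_self hs)).trans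
      (Set.image_id' _)
  have hβ : β ∈ (Subgroup.closure (genB n)).toSubmonoid := by rw [closure_genB]; trivial
  rw [Subgroup.closure_toSubmonoid, hinv, Set.union_self] at hβ
  exact Submonoid.exists_list_of_mem_closure hβ

/-- The map `i ↦ |β i|` of `{1, …, n}` to itself. -/
noncomputable def absFun {n : ℕ} (β : HypGroup n) (x : {x : SignedIdx n // 0 < (x : ℤ)}) :
    {x : SignedIdx n // 0 < (x : ℤ)} :=
  if h : 0 < ((β.1 x.1 : SignedIdx n) : ℤ) then ⟨β.1 x.1, h⟩
  else ⟨-β.1 x.1, by have := idx_bounds (β.1 x.1); rw [coe_neg_idx]; omega⟩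

theorem coe_absFun {n : ℕ} (β : HypGroup n) (x : {x : SignedIdx n // 0 < (x : ℤ)}) :
    ((absFun β x).1 : ℤ) = |((β.1 x.1 : SignedIdx n) : ℤ)| := by
  rw [absFun]
  split_ifs with h
  · exact (abs_of_pos h).symm
  · rw [abs_of_nonpos (not_lt.1 h)]; rfl

theorem absFun_mul {n : ℕ} (β γ : HypGroup n) (x : {x : SignedIdx n // 0 < (x : ℤ)}) :
    absFun (β * γ) x = absFun β (absFun γ x) := by
  refine Subtype.ext (Subtype.ext ?_)
  rw [coe_absFun, coe_absFun, coe_mul_apply]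
  conv_rhs => rw [absFun]
  split_ifs with h
  · rfl
  · rw [apply_neg, coe_neg_idx, abs_neg]

theorem absFun_one {n : ℕ} (x : {x : SignedIdx n // 0 < (x : ℤ)}) :
    absFun (1 : HypGroup n) x = x :=
  Subtype.ext (Subtype.ext ((coe_absFun _ _).trans (abs_of_pos x.2)))

/-- The homomorphism from `B_n` to the symmetric group that forgets the signs. -/
noncomputable def absHom (n : ℕ) : HypGroup n →* Equiv.Perm {x : SignedIdx n // 0 < (x : ℤ)} where
  toFun β := ⟨absFun β, absFun β⁻¹,
    fun x => by rw [← absFun_mul, inv_mul_cancel, absFun_one],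
    fun x => by rw [← absFun_mul, mul_inv_cancel, absFun_one]⟩
  map_one' := Equiv.ext absFun_one
  map_mul' β γ := Equiv.ext (absFun_mul β γ)

theorem coe_absHom_apply {n : ℕ} (β : HypGroup n) (x : {x : SignedIdx n // 0 < (x : ℤ)}) :
    ((absHom n β x).1 : ℤ) = |((β.1 x.1 : SignedIdx n) : ℤ)| := coe_absFun β x

/-- The linear character of `B_n` that takes the value `-1` at every generator. The first factor
is `-1` exactly at the generators `s_i` with `i ≥ 1`, the second exactly at `s_0`. -/
noncomputable def signB (n : ℕ) : HypGroup n →* ℤˣ :=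
  (Equiv.Perm.sign.comp (absHom n)) * (Equiv.Perm.sign.comp (HypGroup n).subtype)

theorem signB_genB {n : ℕ} {s : HypGroup n} (h : s ∈ genB n) : signB n s = -1 := by
  rcases h with ⟨i, h₁, h₂, rfl⟩ | ⟨h, rfl⟩
  · have habs : absHom n (sGen i h₁ h₂) =
        Equiv.swap ⟨posIdx i h₁ (by omega), by rw [coe_posIdx]; omega⟩
          ⟨posIdx (i + 1) (by omega) h₂, by rw [coe_posIdx]; omega⟩ := by
      refine Equiv.ext fun x => Subtype.ext (Subtype.ext ?_)
      have hx := x.2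
      rw [coe_absHom_apply, coe_sGen_apply]
      simp only [Equiv.swap_apply_def, posIdx, Subtype.ext_iff]
      split_ifs <;> simp only [abs_eq_max_neg] <;> push_cast at * <;> omega
    have hne : posIdx i h₁ (by omega) ≠ posIdx (n := n) (i + 1) (by omega) h₂ := by
      simp only [posIdx, ne_eq, Subtype.ext_iff]; push_cast; omega
    change Equiv.Perm.sign (absHom n _) * Equiv.Perm.sign (sGen i h₁ h₂).1 = -1
    rw [habs, Equiv.Perm.sign_swap (by simpa only [ne_eq, Subtype.mk.injEq] using hne), sGen,
      Equiv.Perm.sign_mul, Equiv.Perm.sign_swap hne, Equiv.Perm.sign_swap (neg_injective.ne hne)]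
    rfl
  · have habs : absHom n (sZero h) = 1 := by
      refine Equiv.ext fun x => Subtype.ext (Subtype.ext ?_)
      have hx := x.2
      rw [coe_absHom_apply, coe_sZero_apply, Equiv.Perm.one_apply]
      split_ifs <;> simp only [abs_eq_max_neg] <;> omega
    change Equiv.Perm.sign (absHom n _) * Equiv.Perm.sign (sZero h).1 = -1
    rw [habs, sZero, Equiv.Perm.sign_swap (neg_idx_ne _).symm, Equiv.Perm.sign_one, one_mul]

theorem neg_one_pow_lengthB {n : ℕ} (β : HypGroup n) : (-1 : ℤˣ) ^ lengthB β = signB n β := by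
  obtain ⟨w, hw, hp⟩ := exists_word β
  obtain ⟨v, hv, rfl, hl⟩ := Nat.sInf_mem (s := {k : ℕ | ∃ w : List (HypGroup n),
    (∀ s ∈ w, s ∈ genB n) ∧ w.prod = β ∧ w.length = k}) ⟨w.length, w, hw, hp, rfl⟩
  rw [lengthB, ← hl, map_list_prod, List.eq_replicate_of_mem (a := (-1 : ℤˣ)) (l := v.map (signB n))
    (fun b hb => by
      obtain ⟨s, hs, rfl⟩ := List.mem_map.1 hb
      exact signB_genB (hv s hs)), List.prod_replicate, List.length_map]

theorem signB_incl {n : ℕ} (β : HypGroup n) : signB (n + 1) (incl n β) = signB n β := by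
  refine DFunLike.congr_fun (f := (signB (n + 1)).comp (incl n)) (g := signB n) ?_ β
  refine MonoidHom.eq_of_eqOn_dense (closure_genB n) fun s hs => ?_
  rw [MonoidHom.comp_apply, signB_genB hs, signB_genB (incl_mem_genB hs)]

theorem signB_cyc (n : ℕ) : signB (n + 1) (cyc n) = (-1) ^ (n + 1) := by
  induction n with
  | zero => rw [cyc, signB_genB (Or.inr ⟨le_rfl, rfl⟩), zero_add, pow_one]
  | succ n ih =>
    rw [cyc, map_mul, signB_incl, ih, signB_genB (Or.inl ⟨_, _, le_rfl, rfl⟩), pow_succ' _ (n + 1)]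

/-! ### The flag-major index -/

theorem maj_eq_sum {n : ℕ} (v : Fin n → ℤ) :
    maj v = ∑ i : Fin n, if ∃ h : i.val + 1 < n, Prec (v ⟨i.val + 1, h⟩) (v i)
      then i.val + 1 else 0 := by
  rw [maj, descents, Finset.sum_filter]

theorem negCount_eq_sum {n : ℕ} (v : Fin n → ℤ) :
    negCount v = ∑ i : Fin n, if v i < 0 then 1 else 0 := by
  rw [negCount, Finset.card_filter]

theorem window_last {n : ℕ} (β : HypGroup (n + 1)) :
    window β (Fin.last n) = (β.1 (top n) : SignedIdx (n + 1)) := rfl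

theorem window_castSucc_incl {n : ℕ} (β : HypGroup n) (i : Fin n) :
    window (incl n β) i.castSucc = window β i :=
  coe_incl_small β _ _ rfl

theorem window_bounds {n : ℕ} (β : HypGroup n) (i : Fin n) :
    window β i ≠ 0 ∧ -(n : ℤ) ≤ window β i ∧ window β i ≤ n :=
  idx_bounds _

theorem fmaj_incl {n : ℕ} (β : HypGroup n) : fmaj (incl n β) = fmaj β := by
  have hlast : window (incl n β) (Fin.last n) = n + 1 := by
    rw [window_last, incl_top, coe_posIdx]; push_cast; rfl
  have hneg : negCount (window (incl n β)) = negCount (window β) := by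
    rw [negCount_eq_sum, negCount_eq_sum, Fin.sum_univ_castSucc, hlast,
      if_neg (by omega), add_zero]
    exact Finset.sum_congr rfl fun i _ => by rw [window_castSucc_incl]
  have hmaj : maj (window (incl n β)) = maj (window β) := by
    rw [maj_eq_sum, maj_eq_sum, Fin.sum_univ_castSucc, if_neg (by simp), add_zero]
    refine Finset.sum_congr rfl fun i _ => ?_
    refine if_congr ?_ rfl rfl
    rw [window_castSucc_incl]
    by_cases hi : i.val + 1 < n
    · have : window (incl n β) ⟨i.val + 1, by omega⟩ = window β ⟨i.val + 1, hi⟩ :=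
        window_castSucc_incl β ⟨i.val + 1, hi⟩
      simp [this, hi]
    · have hi' : (⟨i.val + 1, by omega⟩ : Fin (n + 1)) = Fin.last n :=
        Fin.ext (by simp only [Fin.val_last]; omega)
      have hb := window_bounds β i
      constructor
      · rintro ⟨h, hp⟩
        change Prec (window (incl n β) ⟨i.val + 1, _⟩) _ at hp
        rw [hi', hlast, Prec] at hp
        omega
      · rintro ⟨h, -⟩
        exact absurd h hi
  rw [fmaj, fmaj, hneg, hmaj]

theorem window_cyc_mul {n : ℕ} (β : HypGroup (n + 1)) (i : Fin (n + 1)) :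
    window (cyc n * β) i = cycPred (n + 1) (window β i) :=
  coe_cyc_apply n _

theorem abs_window_injective {n : ℕ} (β : HypGroup n) {i j : Fin n}
    (h : |window β i| = |window β j|) : i = j := by
  rcases abs_eq_abs.1 h with h | h
  · have := congrArg Subtype.val (β.1.injective (Subtype.ext h))
    rw [coe_posIdx, coe_posIdx] at this
    exact Fin.ext (by omega)
  · have h' := β.1.injective ((Subtype.ext h).trans (apply_neg β _).symm)
    have := congrArg Subtype.val h'
    rw [coe_neg_idx, coe_posIdx, coe_posIdx] at this
    omega

theorem exists_abs_window_eq_one {n : ℕ} (β : HypGroup (n + 1)) :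
    ∃ j, |window β j| = 1 := by
  obtain ⟨x, hx⟩ := β.1.surjective (posIdx 1 le_rfl (Nat.le_add_left 1 n))
  have hb := idx_bounds x
  push_cast at hb
  rcases lt_or_gt_of_ne hb.1 with h | h
  · refine ⟨⟨(-(x : ℤ)).toNat - 1, by omega⟩, ?_⟩
    have : window β ⟨(-(x : ℤ)).toNat - 1, by omega⟩ = (β.1 (-x) : SignedIdx (n + 1)) := by
      rw [window]; congr 2; apply Subtype.ext; rw [coe_posIdx, coe_neg_idx]; dsimp only; omega
    rw [this, apply_neg, hx]; rfl
  · refine ⟨⟨(x : ℤ).toNat - 1, by omega⟩, ?_⟩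
    have : window β ⟨(x : ℤ).toNat - 1, by omega⟩ = (β.1 x : SignedIdx (n + 1)) := by
      rw [window]; congr 2; apply Subtype.ext; rw [coe_posIdx]; dsimp only; omega
    rw [this, hx]; rfl

/-- Away from the minimum `-1`, the predecessor map preserves the order `≺`. -/
theorem prec_cycPred_iff {N a b : ℤ} (ha : a ≠ 0 ∧ -N ≤ a ∧ a ≤ N) (hb : b ≠ 0 ∧ -N ≤ b ∧ b ≤ N)
    (ha' : a ≠ -1) (hb' : b ≠ -1) : Prec (cycPred N a) (cycPred N b) ↔ Prec a b := by
  simp only [Prec, cycPred]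
  split_ifs <;> omega

/-- Multiplying by the cycle from the left adds `1` to the flag-major index, unless the window ends
in `-1`. Only the entry `±1` changes its place in the order `≺` or its sign. -/
theorem fmaj_cyc_mul {n : ℕ} (β : HypGroup (n + 1)) (h : window β (Fin.last n) ≠ -1) :
    fmaj (cyc n * β) = fmaj β + 1 := by
  obtain ⟨j, hj⟩ := exists_abs_window_eq_one β
  have hne : ∀ i, i ≠ j → window β i ≠ 1 ∧ window β i ≠ -1 := fun i hi =>
    ⟨fun he => hi (abs_window_injective β (by rw [he, hj]; rfl)),
      fun he => hi (abs_window_injective β (by rw [he, hj]; rfl))⟩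
  have hb : ∀ i, window β i ≠ 0 ∧ -((n : ℤ) + 1) ≤ window β i ∧ window β i ≤ (n : ℤ) + 1 :=
    fun i => by have := window_bounds β i; push_cast at this; omega
  rcases abs_eq (zero_le_one) |>.1 hj with hj | hj
  · -- The entry `1` becomes `-(n+1)`: one more negative entry, the descents stay.
    have hne' : ∀ i, window β i ≠ -1 := fun i => by
      by_cases hi : i = j
      · rw [hi, hj]; decide
      · exact (hne i hi).2
    have hmaj : maj (window (cyc n * β)) = maj (window β) := by
      rw [maj_eq_sum, maj_eq_sum]
      refine Finset.sum_congr rfl fun i _ => if_congr ?_ rfl rfl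
      refine exists_congr fun hi => ?_
      rw [window_cyc_mul, window_cyc_mul]
      exact prec_cycPred_iff (hb _) (hb _) (hne' _) (hne' _)
    have hneg : negCount (window (cyc n * β)) = negCount (window β) + 1 := by
      suffices h1 : negCount (window (cyc n * β)) =
          negCount (window β) + ∑ i : Fin (n + 1), if j = i then 1 else 0 by
        rwa [Fintype.sum_ite_eq] at h1
      rw [negCount_eq_sum, negCount_eq_sum, ← Finset.sum_add_distrib]
      refine Finset.sum_congr rfl fun i _ => ?_
      rw [window_cyc_mul]
      by_cases hi : i = j
      · subst hi
        rw [hj, cycPred_one, if_pos rfl]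
        split_ifs <;> omega
      · have := hb i
        have := hne i hi
        rw [if_neg (Ne.symm hi), cycPred]
        split_ifs <;> omega
    rw [fmaj, fmaj, hmaj, hneg, add_assoc]
  · -- The minimal entry `-1`, at position `p = j + 1`, becomes the maximum `n+1`: one negative
    -- entry less, the descent at `p - 1` (if `p > 1`) is lost, and a descent at `p` is gained.
    have hjn : j.val < n := by
      by_contra hc
      exact h (by rw [← hj]; congr 1; exact Fin.ext (by rw [Fin.val_last]; omega))
    have hneg : negCount (window (cyc n * β)) + 1 = negCount (window β) := by
      suffices h1 : negCount (window (cyc n * β)) +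
          (∑ i : Fin (n + 1), if j = i then 1 else 0) = negCount (window β) by
        rwa [Fintype.sum_ite_eq] at h1
      rw [negCount_eq_sum, negCount_eq_sum, ← Finset.sum_add_distrib]
      refine Finset.sum_congr rfl fun i _ => ?_
      rw [window_cyc_mul]
      by_cases hi : i = j
      · subst hi
        rw [hj, cycPred_neg_one, if_pos rfl]
        split_ifs <;> omega
      · have := hb i
        have := hne i hi
        rw [if_neg (Ne.symm hi), cycPred]
        split_ifs <;> omega
    -- Both sums have at most one term that does not vanish: the lost and the gained position.
    have hmaj : maj (window (cyc n * β)) +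
        (∑ i : Fin (n + 1), if i.val + 1 = j.val then i.val + 1 else 0) =
        maj (window β) + ∑ i : Fin (n + 1), if i = j then i.val + 1 else 0 := by
      rw [maj_eq_sum, maj_eq_sum, ← Finset.sum_add_distrib, ← Finset.sum_add_distrib]
      refine Finset.sum_congr rfl fun i _ => ?_
      by_cases hin : i.val + 1 < n + 1
      · simp only [hin, exists_true_left, window_cyc_mul]
        by_cases hi : i = j
        · subst hi
          have h1 := hb ⟨i.val + 1, hin⟩
          have h2 := hne ⟨i.val + 1, hin⟩ (by simp [Fin.ext_iff])
          have hold : ¬ Prec (window β ⟨i.val + 1, hin⟩) (-1) := by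
            simp only [Prec]; omega
          have hnew : Prec (cycPred (n + 1) (window β ⟨i.val + 1, hin⟩))
              (cycPred (n + 1) (-1)) := by
            rw [cycPred_neg_one, Prec, cycPred]
            split_ifs <;> omega
          rw [hj, if_pos hnew, if_neg (by omega), if_neg hold, if_pos rfl, add_zero, zero_add]
        · by_cases hi' : i.val + 1 = j.val
          · have h1 := hb i
            have h2 := hne i hi
            have hij : (⟨i.val + 1, hin⟩ : Fin (n + 1)) = j := Fin.ext hi'
            have hold : Prec (-1) (window β i) := by
              simp only [Prec]; omega
            have hnew : ¬ Prec (cycPred (n + 1) (-1)) (cycPred (n + 1) (window β i)) := by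
              rw [cycPred_neg_one, Prec, cycPred]
              split_ifs <;> omega
            rw [hij, hj, if_neg hnew, if_pos hi', if_pos hold, if_neg hi, add_comm]
          · rw [if_neg hi', if_neg hi]
            have h2 := hne ⟨i.val + 1, hin⟩ (by simpa [Fin.ext_iff] using hi')
            rw [if_congr (prec_cycPred_iff (hb _) (hb _) h2.2 (hne i hi).2) rfl rfl]
      · have hij : i ≠ j := fun he => hin (by rw [he]; omega)
        have hij' : ¬ i.val + 1 = j.val := by omega
        simp [hin, hij, hij']
    have hs1 : (∑ i : Fin (n + 1), if i.val + 1 = j.val then i.val + 1 else 0) = j.val := by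
      rw [Fin.sum_univ_eq_sum_range (fun i => if i + 1 = j.val then i + 1 else 0)]
      cases hjv : j.val with
      | zero => simp
      | succ m =>
        simp only [Nat.add_right_cancel_iff]
        rw [Finset.sum_ite_eq' , if_pos (by rw [Finset.mem_range]; omega)]
    rw [hs1, Finset.sum_ite_eq', if_pos (Finset.mem_univ _)] at hmaj
    rw [fmaj, fmaj]
    omega

theorem fmaj_cyc_pow_mul_incl {n : ℕ} (β : HypGroup n) (k : ℕ) (hk : k < 2 * n + 2) :
    fmaj (cyc n ^ k * incl n β) = fmaj β + k := by
  induction k with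
  | zero => rw [pow_zero, one_mul, fmaj_incl, add_zero]
  | succ k ih =>
    rw [pow_succ', mul_assoc, fmaj_cyc_mul, ih (by omega), add_assoc]
    rw [window_last, coe_mul_apply, incl_top, coe_cyc_pow_top n k (by omega)]
    split_ifs <;> omega

/-! ### The signed generating functions -/

variable {R : Type*} [CommRing R]

/-- The term `(-1) ^ ℓ_B(β) * q ^ fmaj(β)`. -/
noncomputable def weight (q : R) {n : ℕ} (β : HypGroup n) : R := (-1) ^ lengthB β * q ^ fmaj β

theorem neg_one_pow_lengthB_cast {n : ℕ} (β : HypGroup n) :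
    (-1 : R) ^ lengthB β = ((signB n β : ℤ) : R) := by
  rw [← neg_one_pow_lengthB]; push_cast; rfl

theorem weight_cyc_pow_mul_incl (q : R) {n : ℕ} (β : HypGroup n) (k : ℕ) (hk : k < 2 * n + 2) :
    weight q (cyc n ^ k * incl n β) = ((-1) ^ (n + 1) * q) ^ k * weight q β := by
  rw [weight, weight, fmaj_cyc_pow_mul_incl β k hk, neg_one_pow_lengthB_cast,
    neg_one_pow_lengthB_cast, map_mul, map_pow, signB_cyc, signB_incl]
  push_cast
  ring

theorem sum_eq_sum_cyc_pow_mul_incl {n : ℕ} (f : HypGroup (n + 1) → R) :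
    ∑ β, f β = ∑ k : Fin (2 * n + 2), ∑ β : HypGroup n, f (cyc n ^ (k : ℕ) * incl n β) := by
  rw [← (bijective_cyc_pow_mul_incl n).sum_comp f, Fintype.sum_prod_type]

/-- The signed generating function of `fmaj` over the whole group `B_n`. -/
theorem sum_weight (q : R) (n : ℕ) :
    ∑ β : HypGroup n, weight q β = ∏ i ∈ Finset.Icc 1 n, qInt (2 * i) ((-1 : R) ^ i * q) := by
  induction n with
  | zero =>
    have := subsingleton_hypGroup_zero
    rw [Fintype.sum_subsingleton _ (1 : HypGroup 0), weight, neg_one_pow_lengthB_cast]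
    simp [fmaj, maj, negCount, descents]
  | succ n ih =>
    rw [Finset.prod_Icc_succ_top (by omega), ← ih, sum_eq_sum_cyc_pow_mul_incl,
      mul_comm (∑ β : HypGroup n, weight q β), qInt, Finset.sum_mul,
      show 2 * (n + 1) = 2 * n + 2 by ring, ← Fin.sum_univ_eq_sum_range
        (fun k => ((-1 : R) ^ (n + 1) * q) ^ k * ∑ β : HypGroup n, weight q β)]
    refine Finset.sum_congr rfl fun k _ => ?_
    rw [Finset.mul_sum]
    exact Finset.sum_congr rfl fun β _ => weight_cyc_pow_mul_incl q β k k.2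

theorem window_last_pos_iff {n : ℕ} (β : HypGroup n) (k : ℕ) (hk : k < 2 * n + 2) :
    0 < window (cyc n ^ k * incl n β) (Fin.last n) ↔ k < n + 1 := by
  rw [window_last, coe_mul_apply, incl_top, coe_cyc_pow_top n k hk]
  split_ifs <;> omega

/-- The last entry of `c ^ k * β`, for `β ∈ B_n`, is positive exactly for the first half
`k < n + 1` of the powers; this truncates the last factor of the sum over `B_{n+1}`. -/
theorem sum_delta_weight (q : R) (n : ℕ) :
    ∑ γ : Delta (n + 1), weight q γ.1 =
      (∏ i ∈ Finset.Icc 1 n, qInt (2 * i) ((-1 : R) ^ i * q)) *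
        qInt (n + 1) ((-1 : R) ^ (n + 1) * q) := by
  rw [← Finset.sum_subtype (Finset.univ.filter fun β : HypGroup (n + 1) =>
      0 < window β (Fin.last n)) (fun β => by simp [Fin.last]) (weight q), Finset.sum_filter,
    sum_eq_sum_cyc_pow_mul_incl, ← sum_weight,
    mul_comm (∑ β : HypGroup n, weight q β), qInt, Finset.sum_mul,
    Fin.sum_univ_eq_sum_range (fun k => ∑ β : HypGroup n,
      if 0 < window (cyc n ^ k * incl n β) (Fin.last n) then
        weight q (cyc n ^ k * incl n β) else 0),
    ← Finset.sum_subset (Finset.range_subset_range.2 (show n + 1 ≤ 2 * n + 2 by omega))]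
  · refine Finset.sum_congr rfl fun k hk => ?_
    rw [Finset.mem_range] at hk
    rw [Finset.mul_sum]
    refine Finset.sum_congr rfl fun β _ => ?_
    rw [if_pos ((window_last_pos_iff β k (by omega)).2 hk),
      weight_cyc_pow_mul_incl q β k (by omega)]
  · intro k hk hk'
    rw [Finset.mem_range] at hk hk'
    exact Finset.sum_eq_zero fun β _ => if_neg fun h => hk' ((window_last_pos_iff β k hk).1 h)

end SignedMahonian

theorem mainTheorem5 {R : Type*} [CommRing R] (q : R) (n : ℕ) (hn : 1 ≤ n) :
    (Even n →
      ∑ γ : SignedMahonian.Delta n,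
          (-1 : R) ^ SignedMahonian.lengthB γ.1 * q ^ SignedMahonian.Dmaj γ =
        (∏ i ∈ Finset.Icc 1 (n - 1), SignedMahonian.qInt (2 * i) ((-1 : R) ^ i * q)) *
          SignedMahonian.qInt n q) ∧
    (Odd n →
      ∑ γ : SignedMahonian.Delta n,
          (-1 : R) ^ SignedMahonian.lengthB γ.1 * q ^ SignedMahonian.Dmaj γ =
        (∏ i ∈ Finset.Icc 1 (n - 1), SignedMahonian.qInt (2 * i) ((-1 : R) ^ i * q)) *
          SignedMahonian.qInt n (-q)) := by
  obtain ⟨m, rfl⟩ : ∃ m, n = m + 1 := ⟨n - 1, by omega⟩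
  have key := SignedMahonian.sum_delta_weight q m
  constructor
  · intro he
    rw [he.neg_one_pow, one_mul] at key
    exact key
  · intro ho
    rw [ho.neg_one_pow, neg_one_mul] at key
    exact key
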